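/- Let $C=C[0,1]$ be the space of continuous real functions on $[0,1]$ with the maximum norm and $L=L_1[0,1]$ the space of Lebesgue integrable functions. Let $p:(0,1]\to(0,\infty)$ be integrable on $[\varepsilon,1]$ for every $\varepsilon\in(0,1)$, with $\lim_{\varepsilon\to0+}\int_\varepsilon^1p(t)\,dt=\infty$, and let $k<0$. Let $D_-$ be the set of all functions $x$ that are locally absolutely continuous on $(0,1]$, satisfy $\dot x(t)=-k\,p(t)x(t)+g(t)$ for almost all $t\in(0,1]$ with some $g\in L$, and are extended to $t=0$ by continuity, so that they are regarded as elements of $C$. A linear operator $C\to L$ is called positive if it maps nonnegative functions to almost everywhere nonnegative functions. **Theorem.** Let $\mathcal T^+,\mathcal T^-\ge0$ be given. In order that for all operators $T=T^+-T^-$, where $T^+,T^-:C\to L$ are positive linear operators with $$\|T^+\|_{C\to L}=\mathcal T^+,\qquad \|T^-\|_{C\to L}=\mathcal T^-,$$ the problem $$\dot x(t)=-k\,p(t)x(t)+(Tx)(t)\ \text{ for almost all } t\in[0,1],\qquad x(1)=c,$$ be uniquely solvable in $D_-$ (that is, have exactly one solution $x\in D_-$ for every $c\in\mathbb R$), it is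 necessary and sufficient that $$\mathcal T^-\le1,\qquad \mathcal T^+\le2\sqrt{1-\mathcal T^-}.$$ The same two inequalities are necessary and sufficient in order that, for all such $T$, the problem $$\dot x(t)=-k\,p(t)x(t)+(Tx)(t)+f(t)\ \text{ for almost all } t\in[0,1],\qquad x(1)=c,$$ have exactly one solution $x\in D_-$ for every $f\in L$ and every $c\in\mathbb R$. -/

import Mathlib

open MeasureTheory Set Filter Topology

/-- Lebesgue measure on `[0,1]`, as a measure on the real line. -/
noncomputable abbrev lebesgue01 : Measure ℝ := volume.restrict (Icc (0 : ℝ) 1)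

/-- The Banach space `C[0,1]` of continuous real functions, with the maximum norm. -/
abbrev SpaceC : Type := C(Icc (0 : ℝ) 1, ℝ)

/-- The Banach space `L[0,1]` of (classes of) Lebesgue integrable real functions. -/
abbrev SpaceL : Type := Lp ℝ 1 lebesgue01

/-- The value of `x ∈ C[0,1]` at a real number `t`; only `t ∈ [0,1]` matters. Outside `[0,1]` the
function is continued by its end point values. -/
noncomputable def SpaceC.val (x : SpaceC) : ℝ → ℝ :=
  Set.IccExtend (zero_le_one : (0 : ℝ) ≤ 1) x

/-- A positive weight on `(0,1]`, integrable on every `[ε,1]`, with divergent integral at `0`. -/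
structure IsSingularWeight (p : ℝ → ℝ) : Prop where
  pos : ∀ t ∈ Ioc (0 : ℝ) 1, 0 < p t
  integrableOn : ∀ ε ∈ Ioo (0 : ℝ) 1, IntegrableOn p (Icc ε 1)
  tendsto_integral : Tendsto (fun ε : ℝ => ∫ t in ε..1, p t) (𝓝[>] 0) atTop

/-- `x`, continuous on `[0,1]`, is locally absolutely continuous on `(0,1]` and satisfies
`x'(t) = - k p(t) x(t) + g(t)` for almost all `t ∈ [0,1]`. -/
def SolvesModel (k : ℝ) (p : ℝ → ℝ) (g : SpaceL) (x : SpaceC) : Prop :=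
  (∀ ε ∈ Ioo (0 : ℝ) 1, AbsolutelyContinuousOnInterval x.val ε 1) ∧
    ∀ᵐ t ∂lebesgue01, HasDerivAt x.val (-k * p t * x.val t + g t) t

/-- The space `D₋` (for `k < 0`), as a set: all solutions of the model equations
`x' = - k p x + g`, `g ∈ L[0,1]`, extended to `t = 0` by continuity. -/
def DMinus (k : ℝ) (p : ℝ → ℝ) : Set SpaceC :=
  {x | ∃ g : SpaceL, SolvesModel k p g x}

/-- A positive operator `C[0,1] → L[0,1]`: it maps nonnegative functions to functions that are
nonnegative almost everywhere. -/
def IsPositiveOp (T : SpaceC →L[ℝ] SpaceL) : Prop :=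
  ∀ x : SpaceC, (∀ t, 0 ≤ x t) → ∀ᵐ t ∂lebesgue01, 0 ≤ T x t

/-- `x ∈ D₋` is a solution of `x'(t) = - k p(t) x(t) + (T x)(t) + f(t)` (a.e. on `[0,1]`),
`x(1) = c`. -/
def SolvesProblem (k : ℝ) (p : ℝ → ℝ) (T : SpaceC →L[ℝ] SpaceL) (f : SpaceL) (c : ℝ)
    (x : SpaceC) : Prop :=
  x ∈ DMinus k p ∧
    (∀ᵐ t ∂lebesgue01, HasDerivAt x.val (-k * p t * x.val t + T x t + f t) t) ∧
    x.val 1 = c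

/-- Unique solvability in `D₋` of `x' = - k p x + T x`, `x(1) = c`: for every `c` there is exactly
one solution. -/
def UniquelySolvable (k : ℝ) (p : ℝ → ℝ) (T : SpaceC →L[ℝ] SpaceL) : Prop :=
  ∀ c : ℝ, ∃! x : SpaceC, SolvesProblem k p T 0 c x

/-- Unique solvability in `D₋` of `x' = - k p x + T x + f`, `x(1) = c`: for every `f ∈ L[0,1]` and
every `c` there is exactly one solution. -/
def UniquelySolvableForced (k : ℝ) (p : ℝ → ℝ) (T : SpaceC →L[ℝ] SpaceL) : Prop :=
  ∀ (f : SpaceL) (c : ℝ), ∃! x : SpaceC, SolvesProblem k p T f c x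

/-! Put `q = -k p` and `E = decay q`, so that `E' = q E`, `E 1 = 1`, and `E` is continuous at `0`
with `E 0 = 0` because the integral of `q` diverges. Variation of constants turns the problem into
`x + G (T x) = c • E - G f`, where `G` (`greenOp`) has kernel `E t / E s` for `s > t`. Since `|T x|
≤ ‖x‖ (T⁺1 + T⁻1)`, the operator `G ∘ T` is compact, so by the Fredholm alternative both kinds of
unique solvability follow once `x + G (T x) = 0` has only the zero solution.

Sufficiency: let such an `x` have maximum `M` at `t` and minimum `-m` at `u`; `x 0 = 0` gives `M, m
≥ 0`. If `x` has constant sign, `‖T⁻‖ ≤ 1` forces `x = 0`. Otherwise let `t < u`, up to replacing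
`x` by `-x`. With `a₁, a₂` and `b₁, b₂` the integrals of `T⁺1` and `T⁻1` over `[t,u]` and `[u,1]`,
one finds `M (1 - b₁) < m a₁` and `m (1 - b₂) < M a₂`. Hence `1 - ‖T⁻‖ ≤ (1 - b₁)(1 - b₂) < a₁ a₂ ≤
‖T⁺‖² / 4`, a contradiction. Strictness comes from `E t / E s < 1`, which is why the limiting
equalities are admitted.

Necessity: when an inequality fails, operators of finite rank, built from point evaluations and
bumps, have a nonzero homogeneous solution (`exists_ne_zero_of_not_le`). The ratio `E t₁ / E (1/2)`
tends to `0` with `t₁`, so the coupling that would help solvability can be made negligible. -/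

/-! ### Absolute continuity and almost-everywhere tools. -/

theorem AbsolutelyContinuousOnInterval.congr_eqOn {f g : ℝ → ℝ} {a b : ℝ}
    (hf : AbsolutelyContinuousOnInterval f a b) (h : EqOn g f (uIcc a b)) :
    AbsolutelyContinuousOnInterval g a b := by
  rw [absolutelyContinuousOnInterval_iff] at hf ⊢
  intro ε hε
  obtain ⟨δ, hδ, H⟩ := hf ε hε
  refine ⟨δ, hδ, fun I hI hs => ?_⟩
  have := H I hI hs
  rwa [Finset.sum_congr rfl fun i hi => ?_]
  rw [h (hI.1 i hi).1, h (hI.1 i hi).2]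

theorem LipschitzOnWith.comp_absolutelyContinuousOnInterval {φ f : ℝ → ℝ} {a b : ℝ} {s : Set ℝ}
    {C : NNReal} (hφ : LipschitzOnWith C φ s) (hf : AbsolutelyContinuousOnInterval f a b)
    (hs : MapsTo f (uIcc a b) s) : AbsolutelyContinuousOnInterval (fun t => φ (f t)) a b := by
  rw [absolutelyContinuousOnInterval_iff] at hf ⊢
  intro ε hε
  obtain ⟨δ, hδ, H⟩ := hf (ε / (C + 1)) (by positivity)
  refine ⟨δ, hδ, fun I hI hsum => ?_⟩
  calc ∑ i ∈ Finset.range I.1, dist (φ (f (I.2 i).1)) (φ (f (I.2 i).2))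
      ≤ ∑ i ∈ Finset.range I.1, C * dist (f (I.2 i).1) (f (I.2 i).2) :=
        Finset.sum_le_sum fun i hi => hφ.dist_le_mul _ (hs (hI.1 i hi).1) _ (hs (hI.1 i hi).2)
    _ = C * ∑ i ∈ Finset.range I.1, dist (f (I.2 i).1) (f (I.2 i).2) := by rw [Finset.mul_sum]
    _ ≤ C * (ε / (C + 1)) := by gcongr; exact (H I hI hsum).le
    _ < (C + 1) * (ε / (C + 1)) := by gcongr; linarith
    _ = ε := by field

theorem AbsolutelyContinuousOnInterval.exp {f : ℝ → ℝ} {a b : ℝ}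
    (hf : AbsolutelyContinuousOnInterval f a b) :
    AbsolutelyContinuousOnInterval (fun t => Real.exp (f t)) a b := by
  obtain ⟨R, hR⟩ := hf.exists_bound
  obtain ⟨C, hC⟩ := (Real.contDiff_exp (n := 1)).contDiffOn.exists_lipschitzOnWith
    (s := Icc (-R) R) (by decide) (convex_Icc _ _) isCompact_Icc
  exact hC.comp_absolutelyContinuousOnInterval hf fun t ht => abs_le.mp (hR t ht)

theorem ae_lebesgue01_of_forall_Ioo {P : ℝ → Prop}
    (h : ∀ ε ∈ Ioo (0 : ℝ) 1, ∀ᵐ t, t ∈ Ioo ε 1 → P t) : ∀ᵐ t ∂lebesgue01, P t := by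
  rw [lebesgue01, ← Measure.restrict_congr_set Ioo_ae_eq_Icc, ae_restrict_iff' measurableSet_Ioo]
  -- The shift by 2 keeps the left end point below 1 also for `n = 0`.
  have h' : ∀ n : ℕ, ∀ᵐ t, t ∈ Ioo (1 / ((n : ℝ) + 2)) 1 → P t := fun n =>
    h _ ⟨by positivity, by rw [div_lt_one (by positivity)]; linarith [n.cast_nonneg (α := ℝ)]⟩
  filter_upwards [ae_all_iff.mpr h'] with t ht htt
  obtain ⟨n, hn⟩ := exists_nat_one_div_lt htt.1
  refine ht n ⟨lt_of_le_of_lt ?_ hn, htt.2⟩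
  gcongr
  norm_num

/-! ### The homogeneous solution. -/

/-- The solution of `x' = q x`, `x 1 = 1` on `(0,1]`, extended by `0` to `t ≤ 0`. -/
noncomputable def decay (q : ℝ → ℝ) (t : ℝ) : ℝ :=
  if 0 < t then Real.exp (-∫ s in t..1, q s) else 0

section decay

variable {q : ℝ → ℝ}

theorem decay_of_pos {t : ℝ} (ht : 0 < t) : decay q t = Real.exp (-∫ s in t..1, q s) := if_pos ht

theorem decay_pos {t : ℝ} (ht : 0 < t) : 0 < decay q t := by
  rw [decay_of_pos ht]; exact Real.exp_pos _

theorem decay_of_nonpos {t : ℝ} (ht : t ≤ 0) : decay q t = 0 := if_neg ht.not_gt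

@[simp] theorem decay_zero : decay q 0 = 0 := decay_of_nonpos le_rfl

@[simp] theorem decay_one : decay q 1 = 1 := by simp [decay_of_pos]

theorem decay_nonneg (t : ℝ) : 0 ≤ decay q t := by
  unfold decay; split_ifs <;> positivity

theorem IsSingularWeight.intervalIntegrable (hq : IsSingularWeight q) {s t : ℝ} (hs : 0 < s)
    (hs1 : s ≤ 1) (ht : 0 < t) (ht1 : t ≤ 1) : IntervalIntegrable q volume s t := by
  have h : IntegrableOn q (uIcc s t) := by
    refine (hq.integrableOn (min (min s t) (1 / 2)) ⟨by positivity, ?_⟩).mono_set ?_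
    · exact (min_le_right _ _).trans_lt (by norm_num)
    · intro u hu
      exact ⟨(min_le_left _ _).trans hu.1, hu.2.trans (max_le hs1 ht1)⟩
  exact h.intervalIntegrable

theorem IsSingularWeight.integral_pos (hq : IsSingularWeight q) {s t : ℝ} (hs : 0 < s)
    (hst : s < t) (ht : t ≤ 1) : 0 < ∫ u in s..t, q u :=
  intervalIntegral.intervalIntegral_pos_of_pos_on
    (hq.intervalIntegrable hs (hst.le.trans ht) (hs.trans hst) ht)
    (fun u hu => hq.pos u ⟨hs.trans hu.1, hu.2.le.trans ht⟩) hst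

theorem IsSingularWeight.decay_lt (hq : IsSingularWeight q) {s t : ℝ} (hs : 0 ≤ s)
    (hst : s < t) (ht : t ≤ 1) : decay q s < decay q t := by
  rcases hs.eq_or_lt with rfl | hs
  · simpa using decay_pos hst
  · rw [decay_of_pos hs, decay_of_pos (hs.trans hst), Real.exp_lt_exp, neg_lt_neg_iff,
      ← intervalIntegral.integral_add_adjacent_intervals
        (hq.intervalIntegrable hs (hst.le.trans ht) (hs.trans hst) ht)
        (hq.intervalIntegrable (hs.trans hst) ht one_pos le_rfl)]
    linarith [hq.integral_pos hs hst ht]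

theorem IsSingularWeight.decay_le (hq : IsSingularWeight q) {s t : ℝ} (hs : 0 ≤ s)
    (hst : s ≤ t) (ht : t ≤ 1) : decay q s ≤ decay q t := by
  rcases hst.eq_or_lt with rfl | hst
  · rfl
  · exact (hq.decay_lt hs hst ht).le

theorem IsSingularWeight.absolutelyContinuousOnInterval_integral (hq : IsSingularWeight q) {ε : ℝ}
    (hε : ε ∈ Ioo (0 : ℝ) 1) :
    AbsolutelyContinuousOnInterval (fun t => -∫ s in t..1, q s) ε 1 := by
  simp_rw [← intervalIntegral.integral_symm]
  exact (hq.intervalIntegrable hε.1 hε.2.le one_pos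
    le_rfl).absolutelyContinuousOnInterval_intervalIntegral right_mem_uIcc

theorem IsSingularWeight.absolutelyContinuousOnInterval_decay (hq : IsSingularWeight q) {ε : ℝ}
    (hε : ε ∈ Ioo (0 : ℝ) 1) : AbsolutelyContinuousOnInterval (decay q) ε 1 := by
  refine (hq.absolutelyContinuousOnInterval_integral hε).exp.congr_eqOn fun t ht => ?_
  rw [uIcc_of_le hε.2.le] at ht
  exact decay_of_pos (hε.1.trans_le ht.1)

theorem IsSingularWeight.absolutelyContinuousOnInterval_inv_decay (hq : IsSingularWeight q) {ε : ℝ}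
    (hε : ε ∈ Ioo (0 : ℝ) 1) : AbsolutelyContinuousOnInterval (fun t => (decay q t)⁻¹) ε 1 := by
  refine (hq.absolutelyContinuousOnInterval_integral hε).fun_neg.exp.congr_eqOn fun t ht => ?_
  rw [uIcc_of_le hε.2.le] at ht
  simp only [decay_of_pos (hε.1.trans_le ht.1), Real.exp_neg]

theorem IsSingularWeight.continuousAt_decay (hq : IsSingularWeight q) {t : ℝ} (ht : 0 < t)
    (ht1 : t < 1) : ContinuousAt (decay q) t :=
  (hq.absolutelyContinuousOnInterval_decay (ε := t / 2) ⟨by linarith, by linarith⟩).continuousOn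
    |>.continuousAt (by rw [uIcc_of_le (by linarith)]; exact Icc_mem_nhds (by linarith) ht1)

/-- Continuity at `0` is exactly the divergence of the integral of `q`. -/
theorem IsSingularWeight.continuousOn_decay (hq : IsSingularWeight q) :
    ContinuousOn (decay q) (Icc 0 1) := by
  intro t ht
  rcases ht.1.eq_or_lt with rfl | h0
  · have h1 : Tendsto (fun ε => Real.exp (-∫ s in ε..1, q s)) (𝓝[>] 0) (𝓝 0) :=
      Real.tendsto_exp_neg_atTop_nhds_zero.comp hq.tendsto_integral
    have h2 : ContinuousWithinAt (decay q) (Ioi 0) 0 := by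
      rw [ContinuousWithinAt, decay_zero]
      refine h1.congr' ?_
      filter_upwards [self_mem_nhdsWithin] with ε hε using (decay_of_pos hε).symm
    exact (continuousWithinAt_insert_self.mpr h2).mono fun u hu => by
      rcases hu.1.eq_or_lt with rfl | h
      · exact mem_insert _ _
      · exact mem_insert_of_mem _ h
  · have h := (hq.absolutelyContinuousOnInterval_decay (ε := t / 2)
      ⟨by linarith, by linarith [ht.2]⟩).continuousOn
    rw [uIcc_of_le (by linarith [ht.2])] at h
    refine (h t ⟨by linarith, ht.2⟩).mono_of_mem_nhdsWithin ?_
    filter_upwards [self_mem_nhdsWithin, mem_nhdsWithin_of_mem_nhds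
      (Ici_mem_nhds (show t / 2 < t by linarith))] with u hu hu' using ⟨hu', hu.2⟩

theorem IsSingularWeight.ae_hasDerivAt_decay (hq : IsSingularWeight q) :
    ∀ᵐ t ∂lebesgue01, HasDerivAt (decay q) (q t * decay q t) t := by
  refine ae_lebesgue01_of_forall_Ioo fun ε hε => ?_
  filter_upwards [(hq.intervalIntegrable hε.1 hε.2.le one_pos le_rfl).ae_hasDerivAt_integral]
    with t ht htt
  have htε : t ∈ uIcc ε 1 := by rw [uIcc_of_le hε.2.le]; exact ⟨htt.1.le, htt.2.le⟩
  have h := (ht htε 1 right_mem_uIcc).exp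
  have h0 : 0 < t := hε.1.trans htt.1
  have he : decay q =ᶠ[𝓝 t] fun u => Real.exp (∫ s in (1 : ℝ)..u, q s) := by
    filter_upwards [Ioi_mem_nhds h0] with u hu
    rw [decay_of_pos hu, ← intervalIntegral.integral_symm]
  rw [mul_comm, he.eq_of_nhds]
  exact h.congr_of_eventuallyEq he

end decay

/-! ### The Green operator. -/

/-- Green's function of the terminal value problem `x' = q x + g`, `x 1 = 0`, up to sign. -/
noncomputable def greenKernel (q : ℝ → ℝ) (t s : ℝ) : ℝ :=
  if t < s then decay q t / decay q s else 0

/-- The integral operator with kernel `greenKernel q`. -/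
noncomputable def greenFun (q g : ℝ → ℝ) (t : ℝ) : ℝ :=
  ∫ s, greenKernel q t s * g s ∂lebesgue01

section green

variable {q : ℝ → ℝ}

theorem greenKernel_nonneg (t s : ℝ) : 0 ≤ greenKernel q t s := by
  unfold greenKernel
  split_ifs
  · exact div_nonneg (decay_nonneg _) (decay_nonneg _)
  · rfl

theorem IsSingularWeight.decay_div_le_one (hq : IsSingularWeight q) {t s : ℝ} (ht : 0 ≤ t)
    (hts : t ≤ s) (hs : s ≤ 1) : decay q t / decay q s ≤ 1 :=
  div_le_one_of_le₀ (hq.decay_le ht hts hs) (decay_nonneg _)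

theorem IsSingularWeight.greenKernel_le_one (hq : IsSingularWeight q) {t s : ℝ} (ht : 0 ≤ t)
    (hs : s ≤ 1) : greenKernel q t s ≤ 1 := by
  unfold greenKernel
  split_ifs with h
  · exact hq.decay_div_le_one ht h.le hs
  · exact zero_le_one

theorem IsSingularWeight.norm_greenKernel_mul_le (hq : IsSingularWeight q) {t s : ℝ} (ht : 0 ≤ t)
    (hs : s ≤ 1) (y : ℝ) : ‖greenKernel q t s * y‖ ≤ ‖y‖ := by
  rw [norm_mul, Real.norm_of_nonneg (greenKernel_nonneg _ _)]
  exact mul_le_of_le_one_left (norm_nonneg _) (hq.greenKernel_le_one ht hs)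

theorem ae_lebesgue01_mem : ∀ᵐ s ∂lebesgue01, s ∈ Ioo (0 : ℝ) 1 := by
  rw [lebesgue01, ← Measure.restrict_congr_set Ioo_ae_eq_Icc]
  exact ae_restrict_mem measurableSet_Ioo

theorem IsSingularWeight.aestronglyMeasurable_greenKernel (hq : IsSingularWeight q) (t : ℝ) :
    AEStronglyMeasurable (greenKernel q t) lebesgue01 := by
  have h1 : AEStronglyMeasurable (decay q) lebesgue01 :=
    hq.continuousOn_decay.aestronglyMeasurable measurableSet_Icc
  have h2 : AEStronglyMeasurable (fun s => decay q t / decay q s) lebesgue01 :=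
    (h1.aemeasurable.const_div _).aestronglyMeasurable
  exact h2.indicator (measurableSet_Ioi (a := t))

theorem IsSingularWeight.integrable_greenKernel_mul (hq : IsSingularWeight q) {g : ℝ → ℝ}
    (hg : Integrable g lebesgue01) {t : ℝ} (ht : 0 ≤ t) :
    Integrable (fun s => greenKernel q t s * g s) lebesgue01 :=
  hg.mono ((hq.aestronglyMeasurable_greenKernel t).mul hg.1)
    (ae_lebesgue01_mem.mono fun _ hs => hq.norm_greenKernel_mul_le ht hs.2.le _)

theorem IsSingularWeight.continuousWithinAt_greenKernel (hq : IsSingularWeight q) {t s : ℝ}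
    (ht : t ∈ Icc (0 : ℝ) 1) (hts : t ≠ s) :
    ContinuousWithinAt (fun t => greenKernel q t s) (Icc 0 1) t := by
  rcases hts.lt_or_gt with h | h
  · refine ((hq.continuousOn_decay t ht).div_const (decay q s)).congr_of_eventuallyEq ?_
      (if_pos h)
    filter_upwards [mem_nhdsWithin_of_mem_nhds (Iio_mem_nhds h)] with u hu using if_pos hu
  · refine (continuousWithinAt_const (b := (0 : ℝ))).congr_of_eventuallyEq ?_ (if_neg h.not_gt)
    filter_upwards [mem_nhdsWithin_of_mem_nhds (Ioi_mem_nhds h)] with u hu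
      using if_neg (not_lt.mpr (le_of_lt hu))

theorem IsSingularWeight.continuousOn_greenFun (hq : IsSingularWeight q) {g : ℝ → ℝ}
    (hg : Integrable g lebesgue01) : ContinuousOn (greenFun q g) (Icc 0 1) := by
  intro t ht
  refine continuousWithinAt_of_dominated (bound := fun s => ‖g s‖) ?_ ?_ hg.norm ?_
  · exact Eventually.of_forall fun u => (hq.aestronglyMeasurable_greenKernel u).mul hg.1
  · filter_upwards [self_mem_nhdsWithin] with u hu
    exact ae_lebesgue01_mem.mono fun _ hs => hq.norm_greenKernel_mul_le hu.1 hs.2.le _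
  -- For fixed `s` the kernel jumps only at `t = s`, a null set of `s`.
  · have : ∀ᵐ s ∂lebesgue01, s ≠ t := ae_restrict_of_ae (Measure.ae_ne volume t)
    filter_upwards [this] with s hs
    exact (hq.continuousWithinAt_greenKernel ht hs.symm).mul continuousWithinAt_const

theorem greenFun_zero (g : ℝ → ℝ) : greenFun q g 0 = 0 := by
  simp [greenFun, greenKernel]

theorem greenFun_one (g : ℝ → ℝ) : greenFun q g 1 = 0 := by
  refine integral_eq_zero_of_ae (ae_lebesgue01_mem.mono fun s hs => ?_)
  simp [greenKernel, hs.2.not_gt]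

theorem greenFun_congr {g g' : ℝ → ℝ} (h : g =ᵐ[lebesgue01] g') : greenFun q g = greenFun q g' :=
  funext fun _ => integral_congr_ae (h.mono fun s hs => by simp only [hs])

theorem IsSingularWeight.greenFun_add (hq : IsSingularWeight q) {g g' : ℝ → ℝ}
    (hg : Integrable g lebesgue01) (hg' : Integrable g' lebesgue01) {t : ℝ} (ht : 0 ≤ t) :
    greenFun q (g + g') t = greenFun q g t + greenFun q g' t := by
  simp only [greenFun, Pi.add_apply, mul_add]
  exact integral_add (hq.integrable_greenKernel_mul hg ht) (hq.integrable_greenKernel_mul hg' ht)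

theorem greenFun_smul (c : ℝ) (g : ℝ → ℝ) (t : ℝ) :
    greenFun q (c • g) t = c * greenFun q g t := by
  simp only [greenFun, Pi.smul_apply, smul_eq_mul, mul_left_comm _ c, integral_const_mul]

theorem IsSingularWeight.norm_greenFun_le (hq : IsSingularWeight q) {g : ℝ → ℝ}
    (hg : Integrable g lebesgue01) {t : ℝ} (ht : 0 ≤ t) :
    ‖greenFun q g t‖ ≤ ∫ s, ‖g s‖ ∂lebesgue01 :=
  norm_integral_le_of_norm_le hg.norm
    (ae_lebesgue01_mem.mono fun _ hs => hq.norm_greenKernel_mul_le ht hs.2.le _)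

theorem IsSingularWeight.intervalIntegrable_decay_div (hq : IsSingularWeight q) {g : ℝ → ℝ}
    (hg : Integrable g lebesgue01) {t u v : ℝ} (ht : 0 ≤ t) (htu : t ≤ u) (huv : u ≤ v)
    (hv : v ≤ 1) : IntervalIntegrable (fun s => decay q t / decay q s * g s) volume u v := by
  rw [intervalIntegrable_iff_integrableOn_Ioc_of_le huv]
  have h : IntegrableOn (fun s => greenKernel q t s * g s) (Ioc u v) :=
    IntegrableOn.mono_set (hq.integrable_greenKernel_mul hg ht)
      fun s hs => ⟨(ht.trans htu).trans hs.1.le, hs.2.trans hv⟩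
  refine h.congr_fun (fun s hs => ?_) measurableSet_Ioc
  simp only [greenKernel, if_pos (htu.trans_lt hs.1)]

theorem greenFun_eq_intervalIntegral (g : ℝ → ℝ) {t : ℝ} (ht : 0 ≤ t) (ht1 : t ≤ 1) :
    greenFun q g t = ∫ s in t..1, decay q t / decay q s * g s := by
  rw [intervalIntegral.integral_of_le ht1, greenFun, lebesgue01,
    ← inter_eq_right.mpr (show Ioc t 1 ⊆ Icc 0 1 from fun s hs => ⟨ht.trans hs.1.le, hs.2⟩),
    ← setIntegral_indicator measurableSet_Ioc]
  refine setIntegral_congr_fun measurableSet_Icc fun s hs => ?_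
  by_cases h : t < s <;> simp [greenKernel, indicator, h, hs.2]

/-- The kernel is multiplicative: `E t / E s = (E t / E u) (E u / E s)`. This lets the value at one
extremum be expressed through the value at a later one. -/
theorem IsSingularWeight.greenFun_split (hq : IsSingularWeight q) {g : ℝ → ℝ}
    (hg : Integrable g lebesgue01) {t u : ℝ} (ht : 0 ≤ t) (htu : t ≤ u) (hu : 0 < u)
    (hu1 : u ≤ 1) :
    greenFun q g t = (∫ s in t..u, decay q t / decay q s * g s)
      + decay q t / decay q u * greenFun q g u := by
  rw [greenFun_eq_intervalIntegral g ht (htu.trans hu1),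
    greenFun_eq_intervalIntegral g hu.le hu1, ← intervalIntegral.integral_const_mul,
    ← intervalIntegral.integral_add_adjacent_intervals
      (hq.intervalIntegrable_decay_div hg ht le_rfl htu hu1)
      (hq.intervalIntegrable_decay_div hg ht htu hu1 le_rfl)]
  congr 2
  ext s
  have := (decay_pos (q := q) hu).ne'
  field_simp

theorem SpaceL.integrable (g : SpaceL) : Integrable g lebesgue01 := L1.integrable_coeFn g

theorem SpaceC.val_coe (x : SpaceC) (t : Icc (0 : ℝ) 1) : x.val t = x t :=
  IccExtend_val _ _ t

theorem SpaceC.val_of_mem (x : SpaceC) {t : ℝ} (ht : t ∈ Icc (0 : ℝ) 1) : x.val t = x ⟨t, ht⟩ :=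
  IccExtend_of_mem _ _ ht

theorem SpaceC.continuous_val (x : SpaceC) : Continuous x.val := x.continuous.Icc_extend'

/-- The integral operator with kernel `greenKernel q`, acting from `L[0,1]` to `C[0,1]`. -/
noncomputable def IsSingularWeight.greenOp (hq : IsSingularWeight q) : SpaceL →L[ℝ] SpaceC :=
  LinearMap.mkContinuous
    { toFun := fun g => ⟨fun t => greenFun q g t,
        (hq.continuousOn_greenFun g.integrable).domRestrict⟩
      map_add' := fun g g' => by
        ext t
        change greenFun q _ _ = greenFun q _ _ + greenFun q _ _
        rw [greenFun_congr (Lp.coeFn_add g g'), hq.greenFun_add g.integrable g'.integrable t.2.1]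
      map_smul' := fun c g => by
        ext t
        change greenFun q _ _ = c * greenFun q _ _
        rw [greenFun_congr (Lp.coeFn_smul c g), greenFun_smul] } 1 <| fun g => by
    rw [one_mul, ContinuousMap.norm_le _ (norm_nonneg _)]
    intro t
    rw [L1.norm_eq_integral_norm]
    exact hq.norm_greenFun_le g.integrable t.2.1

/-- The function `decay q` as an element of `C[0,1]`. -/
noncomputable def IsSingularWeight.decayC (hq : IsSingularWeight q) : SpaceC :=
  ⟨fun t => decay q t, hq.continuousOn_decay.domRestrict⟩

end green

/-! ### Variation of constants. -/

section representation

variable {q : ℝ → ℝ}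

theorem IsSingularWeight.intervalIntegrable_div_decay (hq : IsSingularWeight q) {g : ℝ → ℝ}
    (hg : Integrable g lebesgue01) {ε : ℝ} (hε : ε ∈ Ioo (0 : ℝ) 1) :
    IntervalIntegrable (fun s => g s / decay q s) volume ε 1 := by
  refine ((hq.intervalIntegrable_decay_div hg hε.1.le le_rfl hε.2.le le_rfl).const_mul
    (decay q ε)⁻¹).congr fun s _ => ?_
  have := (decay_pos (q := q) hε.1).ne'
  field_simp

theorem decay_mul_integral (g : ℝ → ℝ) {t : ℝ} (ht : 0 ≤ t) (ht1 : t ≤ 1) :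
    decay q t * ∫ s in t..1, g s / decay q s = greenFun q g t := by
  rw [greenFun_eq_intervalIntegral g ht ht1, ← intervalIntegral.integral_const_mul]
  congr 1
  ext s
  ring

/-- The quotient `x / decay q` is absolutely continuous on `[t,1]` with derivative `g / decay q`;
integrate it. Nothing is needed at `0`. -/
theorem SolvesModel.eq_decay_mul (hq : IsSingularWeight q) {g : SpaceL} {x : SpaceC}
    (h : SolvesModel (-1) q g x) {t : ℝ} (ht : t ∈ Ioo (0 : ℝ) 1) :
    x.val t = x.val 1 * decay q t - greenFun q g t := by
  have hac := (h.1 t ht).fun_mul (hq.absolutelyContinuousOnInterval_inv_decay ht)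
  have hd : ∀ᵐ s ∂lebesgue01,
      deriv (fun s => x.val s * (decay q s)⁻¹) s = g s / decay q s := by
    filter_upwards [h.2, hq.ae_hasDerivAt_decay, ae_lebesgue01_mem] with s h1 h2 h3
    have h0 := (decay_pos (q := q) h3.1).ne'
    rw [(h1.fun_mul (h2.fun_inv h0)).deriv]
    field_simp
    ring
  have hd' : ∀ᵐ s, s ∈ Ioc t 1 →
      deriv (fun s => x.val s * (decay q s)⁻¹) s = g s / decay q s := by
    rw [← ae_restrict_iff' measurableSet_Ioc]
    exact ae_restrict_of_ae_restrict_of_subset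
      (show Ioc t 1 ⊆ Icc 0 1 from fun s hs => ⟨ht.1.le.trans hs.1.le, hs.2⟩) hd
  have hint := hac.integral_deriv_eq_sub
  rw [intervalIntegral.integral_congr_ae (by rwa [uIoc_of_le ht.2.le])] at hint
  rw [← decay_mul_integral _ ht.1.le ht.2.le, hint, decay_one]
  have h0 := (decay_pos (q := q) ht.1).ne'
  field_simp
  ring

theorem SpaceC.ext_of_Ioo {x y : SpaceC} (h : ∀ t ∈ Ioo (0 : ℝ) 1, x.val t = y.val t) :
    x = y := by
  have h' : EqOn x.val y.val (Icc 0 1) :=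
    EqOn.of_subset_closure h x.continuous_val.continuousOn y.continuous_val.continuousOn
      Ioo_subset_Icc_self (closure_Ioo zero_ne_one).ge
  ext t
  rw [← x.val_coe, ← y.val_coe, h' t.2]

theorem IsSingularWeight.val_smul_decayC_sub (hq : IsSingularWeight q) (c : ℝ) (g : SpaceL)
    {t : ℝ} (ht : t ∈ Icc (0 : ℝ) 1) :
    (c • hq.decayC - hq.greenOp g).val t = c * decay q t - greenFun q g t := by
  rw [SpaceC.val_of_mem _ ht]; rfl

theorem SolvesModel.eq_smul_decayC_sub (hq : IsSingularWeight q) {g : SpaceL} {x : SpaceC}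
    (h : SolvesModel (-1) q g x) : x = x.val 1 • hq.decayC - hq.greenOp g :=
  SpaceC.ext_of_Ioo fun t ht => by
    rw [h.eq_decay_mul hq ht, hq.val_smul_decayC_sub _ _ (Ioo_subset_Icc_self ht)]

theorem IsSingularWeight.solvesModel (hq : IsSingularWeight q) (c : ℝ) (g : SpaceL) :
    SolvesModel (-1) q g (c • hq.decayC - hq.greenOp g) := by
  have hval : ∀ t ∈ Icc (0 : ℝ) 1, (c • hq.decayC - hq.greenOp g).val t
      = decay q t * (c + ∫ s in (1 : ℝ)..t, g s / decay q s) := fun t ht => by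
    rw [hq.val_smul_decayC_sub c g ht, ← decay_mul_integral _ ht.1 ht.2,
      intervalIntegral.integral_symm]
    ring
  constructor
  · intro ε hε
    have hc : AbsolutelyContinuousOnInterval (fun _ => c) ε 1 :=
      (LipschitzWith.const' c).lipschitzOnWith.absolutelyContinuousOnInterval (K := 0)
    refine ((hq.absolutelyContinuousOnInterval_decay hε).fun_mul (hc.fun_add
      ((hq.intervalIntegrable_div_decay g.integrable hε
        ).absolutelyContinuousOnInterval_intervalIntegral right_mem_uIcc))).congr_eqOn ?_
    intro t ht
    rw [uIcc_of_le hε.2.le] at ht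
    exact hval t ⟨hε.1.le.trans ht.1, ht.2⟩
  · have h1 : ∀ᵐ t ∂lebesgue01, HasDerivAt (fun t => ∫ s in (1 : ℝ)..t, g s / decay q s)
        (g t / decay q t) t := by
      refine ae_lebesgue01_of_forall_Ioo fun ε hε => ?_
      filter_upwards [(hq.intervalIntegrable_div_decay g.integrable hε).ae_hasDerivAt_integral]
        with t ht htt
      refine ht ?_ 1 right_mem_uIcc
      rw [uIcc_of_le hε.2.le]
      exact Ioo_subset_Icc_self htt
    filter_upwards [h1, hq.ae_hasDerivAt_decay, ae_lebesgue01_mem] with t h1 h2 h3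
    have h0 := (decay_pos (q := q) h3.1).ne'
    have he : (c • hq.decayC - hq.greenOp g).val =ᶠ[𝓝 t]
        fun t => decay q t * (c + ∫ s in (1 : ℝ)..t, g s / decay q s) := by
      filter_upwards [Icc_mem_nhds h3.1 h3.2] with s hs using hval s hs
    refine ((h2.fun_mul (h1.const_add c)).congr_of_eventuallyEq he).congr_deriv ?_
    rw [he.eq_of_nhds]
    field_simp

theorem solvesProblem_iff (hq : IsSingularWeight q) {T : SpaceC →L[ℝ] SpaceL} {f : SpaceL}
    {c : ℝ} {x : SpaceC} :
    SolvesProblem (-1) q T f c x ↔ x + hq.greenOp (T x) = c • hq.decayC - hq.greenOp f := by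
  have hx : x + hq.greenOp (T x) = c • hq.decayC - hq.greenOp f ↔
      x = c • hq.decayC - hq.greenOp (T x + f) := by
    rw [map_add, ← eq_sub_iff_add_eq]
    constructor <;> intro h <;> refine h.trans ?_ <;> abel
  rw [hx]
  constructor
  · rintro ⟨⟨g, hg⟩, hd, h1⟩
    -- Only local absolute continuity is kept from membership in `DMinus`; the witness `g` is
    -- replaced by `T x + f`.
    have : SolvesModel (-1) q (T x + f) x := by
      refine ⟨hg.1, ?_⟩
      filter_upwards [hd, Lp.coeFn_add (T x) f] with t ht hadd
      rwa [hadd, Pi.add_apply, ← add_assoc]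
    rw [← h1]
    exact this.eq_smul_decayC_sub hq
  · intro h
    have hm : SolvesModel (-1) q (T x + f) x := by
      have := hq.solvesModel c (T x + f)
      rwa [← h] at this
    refine ⟨⟨_, hm⟩, ?_, ?_⟩
    · filter_upwards [hm.2, Lp.coeFn_add (T x) f] with t ht hadd
      rwa [hadd, Pi.add_apply, ← add_assoc] at ht
    · rw [h, hq.val_smul_decayC_sub c _ ⟨zero_le_one, le_rfl⟩, greenFun_one]
      simp

end representation

/-! ### Compactness and the Fredholm alternative. -/

theorem ContinuousMap.isCompact_setOf_modulus {X : Type*} [TopologicalSpace X]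
    (ω : X → X → ℝ) (hω : ∀ x, Tendsto (ω x) (𝓝 x) (𝓝 0)) (R : ℝ) :
    IsCompact {y : C(X, ℝ) | (∀ x, |y x| ≤ R) ∧ ∀ x x', |y x - y x'| ≤ ω x x'} := by
  apply ArzelaAscoli.isCompact_of_equicontinuous
  -- The modulus makes every function in the product set continuous, so the image is a closed subset
  -- of a Tychonoff cube.
  · have himg : ContinuousMap.toFun ''
        {y : C(X, ℝ) | (∀ x, |y x| ≤ R) ∧ ∀ x x', |y x - y x'| ≤ ω x x'} =
        Set.pi univ (fun _ => Icc (-R) R) ∩ {y | ∀ x x', |y x - y x'| ≤ ω x x'} := by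
      ext y
      constructor
      · rintro ⟨z, hz, rfl⟩
        exact ⟨fun x _ => abs_le.mp (hz.1 x), hz.2⟩
      · rintro ⟨h1, h2⟩
        refine ⟨⟨y, continuous_iff_continuousAt.mpr fun x => ?_⟩,
          ⟨fun x => abs_le.mpr (h1 x trivial), h2⟩, rfl⟩
        refine tendsto_iff_dist_tendsto_zero.mpr (squeeze_zero (fun _ => dist_nonneg)
          (fun x' => ?_) (hω x))
        rw [dist_comm]
        exact h2 x x'
    rw [himg]
    refine (isCompact_univ_pi fun _ => isCompact_Icc).inter_right ?_
    simp only [ofPred_forall]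
    refine isClosed_iInter fun x => isClosed_iInter fun x' => isClosed_le ?_ continuous_const
    fun_prop
  · intro x
    exact Metric.equicontinuousAt_of_continuity_modulus (ω x) (hω x) _
      (Eventually.of_forall fun x' y => y.2.2 x x')

section fredholm

variable {q : ℝ → ℝ}

theorem IsSingularWeight.abs_greenKernel_sub_le (hq : IsSingularWeight q) {t t' s : ℝ} (ht : 0 ≤ t)
    (ht' : 0 ≤ t') (hs : s ≤ 1) : |greenKernel q t s - greenKernel q t' s| ≤ 1 := by
  have h1 := hq.greenKernel_le_one ht hs
  have h2 := hq.greenKernel_le_one ht' hs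
  have h3 := greenKernel_nonneg (q := q) t s
  have h4 := greenKernel_nonneg (q := q) t' s
  rw [abs_le]
  constructor <;> linarith

theorem IsSingularWeight.integrable_abs_greenKernel_sub_mul (hq : IsSingularWeight q) {h : ℝ → ℝ}
    (hh : Integrable h lebesgue01) {t t' : ℝ} (ht : 0 ≤ t) (ht' : 0 ≤ t') :
    Integrable (fun s => |greenKernel q t s - greenKernel q t' s| * h s) lebesgue01 := by
  refine hh.bdd_mul (c := 1) (((hq.aestronglyMeasurable_greenKernel t).sub
    (hq.aestronglyMeasurable_greenKernel t')).norm) (ae_lebesgue01_mem.mono fun s hs => ?_)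
  rw [Real.norm_eq_abs, abs_abs]
  exact hq.abs_greenKernel_sub_le ht ht' hs.2.le

theorem IsSingularWeight.tendsto_integral_abs_greenKernel_sub (hq : IsSingularWeight q) {h : ℝ → ℝ}
    (hh : Integrable h lebesgue01) (t : Icc (0 : ℝ) 1) :
    Tendsto (fun t' : Icc (0 : ℝ) 1 =>
      ∫ s, |greenKernel q t s - greenKernel q t' s| * h s ∂lebesgue01) (𝓝 t) (𝓝 0) := by
  have : ContinuousAt (fun t' : Icc (0 : ℝ) 1 =>
      ∫ s, |greenKernel q t s - greenKernel q t' s| * h s ∂lebesgue01) t := by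
    refine continuousAt_of_dominated (bound := fun s => ‖h s‖) ?_ ?_ hh.norm ?_
    · exact Eventually.of_forall fun u =>
        (hq.integrable_abs_greenKernel_sub_mul hh t.2.1 u.2.1).1
    · refine Eventually.of_forall fun u => ae_lebesgue01_mem.mono fun s hs => ?_
      rw [norm_mul, Real.norm_eq_abs, abs_abs]
      exact mul_le_of_le_one_left (norm_nonneg _)
        (hq.abs_greenKernel_sub_le t.2.1 u.2.1 hs.2.le)
    · have : ∀ᵐ s ∂lebesgue01, s ≠ (t : ℝ) := ae_restrict_of_ae (Measure.ae_ne volume (t : ℝ))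
      filter_upwards [this] with s hs
      have hc : ContinuousAt (fun u : Icc (0 : ℝ) 1 => greenKernel q u s) t :=
        (continuousWithinAt_iff_continuousAt_domRestrict _ t.2).mp
          (hq.continuousWithinAt_greenKernel t.2 hs.symm)
      exact (continuousAt_const.sub hc).abs.mul continuousAt_const
  simpa [ContinuousAt] using this

/-- Domination by one integrable `h` gives the images of the unit ball a common modulus of
continuity, the integral of the kernel difference against `h`. -/
theorem IsSingularWeight.isCompactOperator_greenOp_comp (hq : IsSingularWeight q)
    {T : SpaceC →L[ℝ] SpaceL} {h : ℝ → ℝ} (hh : Integrable h lebesgue01)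
    (hT : ∀ x, ∀ᵐ s ∂lebesgue01, |T x s| ≤ ‖x‖ * h s) :
    IsCompactOperator (hq.greenOp ∘L T) := by
  refine (isCompactOperator_iff_exists_mem_nhds_image_subset_compact _).mpr
    ⟨Metric.closedBall 0 1, Metric.closedBall_mem_nhds _ one_pos, _,
      ContinuousMap.isCompact_setOf_modulus _ (hq.tendsto_integral_abs_greenKernel_sub hh)
      ‖hq.greenOp ∘L T‖, ?_⟩
  rintro _ ⟨x, hx, rfl⟩
  have hx1 : ‖x‖ ≤ 1 := mem_closedBall_zero_iff.mp hx
  constructor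
  · intro t
    exact (ContinuousMap.norm_coe_le_norm (hq.greenOp (T x)) t).trans
      ((hq.greenOp ∘L T).unit_le_opNorm x hx1)
  · intro t t'
    change |greenFun q (T x) t - greenFun q (T x) t'| ≤ _
    rw [greenFun, greenFun, ← integral_sub
      (hq.integrable_greenKernel_mul (T x).integrable t.2.1)
      (hq.integrable_greenKernel_mul (T x).integrable t'.2.1), ← Real.norm_eq_abs]
    refine norm_integral_le_of_norm_le
      (hq.integrable_abs_greenKernel_sub_mul hh t.2.1 t'.2.1) ?_
    filter_upwards [hT x, hT 1] with s hs hs1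
    rw [norm_one, one_mul] at hs1
    rw [← sub_mul, norm_mul]
    exact mul_le_mul_of_nonneg_left
      (hs.trans (mul_le_of_le_one_left ((abs_nonneg _).trans hs1) hx1)) (abs_nonneg _)

theorem IsSingularWeight.bijective_add_greenOp (hq : IsSingularWeight q)
    {T : SpaceC →L[ℝ] SpaceL} {h : ℝ → ℝ} (hh : Integrable h lebesgue01)
    (hT : ∀ x, ∀ᵐ s ∂lebesgue01, |T x s| ≤ ‖x‖ * h s)
    (hinj : ∀ x, x + hq.greenOp (T x) = 0 → x = 0) :
    Function.Bijective fun x => x + hq.greenOp (T x) := by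
  have hres := ((hq.isCompactOperator_greenOp_comp hh hT).hasEigenvalue_or_mem_resolventSet
    (μ := -1) (by norm_num)).resolve_left fun hev => by
      obtain ⟨x, hx⟩ := hev.exists_hasEigenvector
      refine hx.2 (hinj x ?_)
      have : hq.greenOp (T x) = (-1 : ℝ) • x := hx.apply_eq_smul
      rw [this]
      simp
  have hu := ContinuousLinearMap.isUnit_iff_bijective.mp (spectrum.mem_resolventSet_iff.mp hres)
  -- The map is minus the resolvent expression at `μ = -1`; injectivity excluded that eigenvalue.
  have heq : (fun x => x + hq.greenOp (T x)) = Equiv.neg SpaceC ∘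
      (algebraMap ℝ (SpaceC →L[ℝ] SpaceC) (-1) - hq.greenOp ∘L T) := by
    funext x
    simp [Algebra.algebraMap_eq_smul_one, add_comm]
  rw [heq]
  exact (Equiv.neg SpaceC).bijective.comp hu

end fredholm

/-! ### Positive operators. -/

section positive

variable {T : SpaceC →L[ℝ] SpaceL}

theorem IsPositiveOp.mono (hT : IsPositiveOp T) {x y : SpaceC} (h : ∀ t, x t ≤ y t) :
    ∀ᵐ s ∂lebesgue01, T x s ≤ T y s := by
  have h1 := hT (y - x) fun t => sub_nonneg.mpr (h t)
  rw [map_sub] at h1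
  filter_upwards [h1, Lp.coeFn_sub (T y) (T x)] with s hs h2
  rw [h2] at hs
  exact sub_nonneg.mp hs

theorem IsPositiveOp.le_mul (hT : IsPositiveOp T) {x : SpaceC} {M : ℝ} (h : ∀ t, x t ≤ M) :
    ∀ᵐ s ∂lebesgue01, T x s ≤ M * T 1 s := by
  have h1 := hT.mono (x := x) (y := M • 1) (by simpa using h)
  rw [map_smul] at h1
  filter_upwards [h1, Lp.coeFn_smul M (T 1)] with s hs h2
  rwa [h2] at hs

theorem IsPositiveOp.mul_le (hT : IsPositiveOp T) {x : SpaceC} {m : ℝ} (h : ∀ t, m ≤ x t) :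
    ∀ᵐ s ∂lebesgue01, m * T 1 s ≤ T x s := by
  have h1 := hT.mono (x := m • 1) (y := x) (by simpa using h)
  rw [map_smul] at h1
  filter_upwards [h1, Lp.coeFn_smul m (T 1)] with s hs h2
  rwa [h2] at hs

theorem IsPositiveOp.apply_one_nonneg (hT : IsPositiveOp T) : ∀ᵐ s ∂lebesgue01, 0 ≤ T 1 s :=
  hT 1 fun _ => zero_le_one

theorem IsPositiveOp.abs_le (hT : IsPositiveOp T) (x : SpaceC) :
    ∀ᵐ s ∂lebesgue01, |T x s| ≤ ‖x‖ * T 1 s := by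
  filter_upwards [hT.le_mul fun t => (_root_.abs_le.mp (x.norm_coe_le_norm t)).2,
    hT.mul_le fun t => (_root_.abs_le.mp (x.norm_coe_le_norm t)).1] with s h1 h2
  rw [_root_.abs_le]
  exact ⟨by linarith, h1⟩

/-- By `|T x| ≤ ‖x‖ T 1` the norm is attained at `1`. Hence bounds on the norm become bounds on the
masses of `T 1` over subintervals. -/
theorem IsPositiveOp.norm_eq (hT : IsPositiveOp T) : ‖T‖ = ∫ s, T 1 s ∂lebesgue01 := by
  have h1 : ‖T 1‖ = ∫ s, T 1 s ∂lebesgue01 := by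
    rw [L1.norm_eq_integral_norm]
    exact integral_congr_ae (hT.apply_one_nonneg.mono fun s hs => Real.norm_of_nonneg hs)
  rw [← h1]
  refine le_antisymm (T.opNorm_le_bound (norm_nonneg _) fun x => ?_) ?_
  · rw [h1, mul_comm, ← integral_const_mul, L1.norm_eq_integral_norm]
    exact integral_mono_ae (T x).integrable.norm ((T 1).integrable.const_mul _) (hT.abs_le x)
  · exact T.unit_le_opNorm 1 (by simp)

end positive

/-! ### Uniqueness by comparing the extrema. -/

section maximum

variable {q : ℝ → ℝ}

/-- The kernel `decay q t / decay q s` is smaller than `1`, hence a strict inequality. -/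
theorem IsSingularWeight.lt_intervalIntegral_of_decay (hq : IsSingularWeight q) {g h : ℝ → ℝ}
    (hg : Integrable g lebesgue01) (hh : Integrable h lebesgue01)
    (hh0 : ∀ᵐ s ∂lebesgue01, 0 ≤ h s) (hgh : ∀ᵐ s ∂lebesgue01, g s ≤ h s) {t u v : ℝ}
    (ht : 0 ≤ t) (htu : t ≤ u) (hu : u ≤ 1) (hv : 0 < v)
    (hv' : v ≤ ∫ s in t..u, decay q t / decay q s * g s) : v < ∫ s in t..u, h s := by
  have hsub : Ioc t u ⊆ Icc 0 1 := fun s hs => ⟨ht.trans hs.1.le, hs.2.trans hu⟩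
  have hig := hq.intervalIntegrable_decay_div hg ht le_rfl htu hu
  have hih := hq.intervalIntegrable_decay_div hh ht le_rfl htu hu
  have hihh : IntervalIntegrable h volume t u :=
    (intervalIntegrable_iff_integrableOn_Ioc_of_le htu).mpr (IntegrableOn.mono_set hh hsub)
  have h0 := ae_restrict_of_ae_restrict_of_subset hsub hh0
  have h1 := ae_restrict_of_ae_restrict_of_subset hsub hgh
  have hmem : ∀ᵐ s ∂volume.restrict (Ioc t u), s ∈ Ioc t u := ae_restrict_mem measurableSet_Ioc
  have hle : ∫ s in t..u, decay q t / decay q s * g s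
      ≤ ∫ s in t..u, decay q t / decay q s * h s := by
    rw [intervalIntegral.integral_of_le htu, intervalIntegral.integral_of_le htu]
    refine integral_mono_ae hig.1 hih.1 (h1.mono fun s hs => ?_)
    exact mul_le_mul_of_nonneg_left hs (div_nonneg (decay_nonneg _) (decay_nonneg _))
  refine (hv'.trans hle).trans_lt ?_
  by_contra! hcon
  have hd0 : 0 ≤ᵐ[volume.restrict (Ioc t u)] fun s => h s - decay q t / decay q s * h s := by
    filter_upwards [h0, hmem] with s hs hs'
    have := hq.decay_div_le_one ht hs'.1.le (hs'.2.trans hu)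
    exact sub_nonneg.mpr (mul_le_of_le_one_left hs this)
  have hint := intervalIntegral.integral_sub hihh hih
  -- If the inequality were not strict, `(1 - E t / E s) h s` would vanish a.e., hence so would `h`,
  -- contradicting `0 < v`.
  have hz : (fun s => h s - decay q t / decay q s * h s) =ᵐ[volume.restrict (Ioc t u)] 0 := by
    rw [← integral_eq_zero_iff_of_nonneg_ae hd0 (hihh.1.sub hih.1)]
    refine le_antisymm ?_ (integral_nonneg_of_ae hd0)
    rw [← intervalIntegral.integral_of_le htu, hint]
    linarith
  have hz' : ∫ s in t..u, decay q t / decay q s * h s = 0 := by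
    rw [intervalIntegral.integral_of_le htu]
    refine integral_eq_zero_of_ae ?_
    filter_upwards [hz, hmem] with s hs hs'
    have hlt : decay q t / decay q s < 1 :=
      (div_lt_one (decay_pos (ht.trans_lt hs'.1))).mpr (hq.decay_lt ht hs'.1 (hs'.2.trans hu))
    have : h s * (1 - decay q t / decay q s) = 0 := by
      rw [mul_one_sub, mul_comm]; exact hs
    rw [(mul_eq_zero.mp this).resolve_right (sub_pos.mpr hlt).ne', mul_zero, Pi.zero_apply]
  linarith

/-- Bounds for `T⁺ x - T⁻ x` when `-m ≤ x ≤ M`. -/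
theorem IsPositiveOp.sub_bounds {Tp Tn : SpaceC →L[ℝ] SpaceL} (hp : IsPositiveOp Tp)
    (hn : IsPositiveOp Tn) {x : SpaceC} {m M : ℝ} (hm : ∀ t, -m ≤ x t) (hM : ∀ t, x t ≤ M) :
    ∀ᵐ s ∂lebesgue01, (Tp - Tn) x s ≤ M * Tp 1 s + m * Tn 1 s ∧
      -((Tp - Tn) x s) ≤ m * Tp 1 s + M * Tn 1 s := by
  filter_upwards [hp.le_mul hM, hp.mul_le hm, hn.le_mul hM, hn.mul_le hm,
    Lp.coeFn_sub (Tp x) (Tn x)] with s h1 h2 h3 h4 h5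
  rw [sub_apply, h5, Pi.sub_apply]
  constructor <;> linarith

theorem integral_mul_add_mul {a b : ℝ → ℝ} (ha : Integrable a lebesgue01)
    (hb : Integrable b lebesgue01) {t u : ℝ} (ht : 0 ≤ t) (htu : t ≤ u) (hu : u ≤ 1) (m M : ℝ) :
    ∫ s in t..u, (m * a s + M * b s) = m * (∫ s in t..u, a s) + M * ∫ s in t..u, b s := by
  have hsub : Ioc t u ⊆ Icc 0 1 := fun s hs => ⟨ht.trans hs.1.le, hs.2.trans hu⟩
  rw [intervalIntegral.integral_of_le htu, intervalIntegral.integral_of_le htu,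
    intervalIntegral.integral_of_le htu, integral_add
    ((IntegrableOn.mono_set ha hsub).const_mul m) ((IntegrableOn.mono_set hb hsub).const_mul M),
    integral_const_mul, integral_const_mul]

theorem integral_add_integral_le {a : ℝ → ℝ} (ha : Integrable a lebesgue01)
    (ha0 : ∀ᵐ s ∂lebesgue01, 0 ≤ a s) {t u : ℝ} (ht : 0 ≤ t) (htu : t ≤ u) (hu : u ≤ 1) :
    0 ≤ (∫ s in t..u, a s) ∧ 0 ≤ (∫ s in u..1, a s) ∧
      (∫ s in t..u, a s) + (∫ s in u..1, a s) ≤ ∫ s, a s ∂lebesgue01 := by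
  have hi : ∀ {v w : ℝ}, 0 ≤ v → v ≤ w → w ≤ 1 → IntervalIntegrable a volume v w :=
    fun hv hvw hw => (intervalIntegrable_iff_integrableOn_Ioc_of_le hvw).mpr
      (IntegrableOn.mono_set ha fun s hs => ⟨hv.trans hs.1.le, hs.2.trans hw⟩)
  have hnn : ∀ {v w : ℝ}, 0 ≤ v → v ≤ w → w ≤ 1 → 0 ≤ ∫ s in v..w, a s := by
    intro v w hv hvw hw
    rw [intervalIntegral.integral_of_le hvw]
    exact integral_nonneg_of_ae (ae_restrict_of_ae_restrict_of_subset
      (show Ioc v w ⊆ Icc 0 1 from fun s hs => ⟨hv.trans hs.1.le, hs.2.trans hw⟩) ha0)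
  refine ⟨hnn ht htu hu, hnn (ht.trans htu) hu le_rfl, ?_⟩
  rw [intervalIntegral.integral_add_adjacent_intervals (hi ht htu hu) (hi (ht.trans htu) hu le_rfl),
    integral_Icc_eq_integral_Ioc, ← intervalIntegral.integral_of_le zero_le_one,
    ← intervalIntegral.integral_add_adjacent_intervals (hi le_rfl ht (htu.trans hu))
      (hi ht (htu.trans hu) le_rfl)]
  linarith [hnn le_rfl ht (htu.trans hu)]

variable {Tp Tn : SpaceC →L[ℝ] SpaceL} {x : SpaceC}

theorem IsSingularWeight.val_eq_neg_greenFun (hq : IsSingularWeight q) {T : SpaceC →L[ℝ] SpaceL}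
    (hx : x + hq.greenOp (T x) = 0) {t : ℝ} (ht : t ∈ Icc (0 : ℝ) 1) :
    x.val t = -greenFun q (T x) t := by
  have h : x = -hq.greenOp (T x) := eq_neg_of_add_eq_zero_left hx
  rw [SpaceC.val_of_mem x ht]
  exact congrArg (fun y : SpaceC => y ⟨t, ht⟩) h

theorem IsSingularWeight.false_of_pos_max (hq : IsSingularWeight q) (hp : IsPositiveOp Tp)
    (hn : IsPositiveOp Tn) (hx : x + hq.greenOp ((Tp - Tn) x) = 0) (hTn : ‖Tn‖ ≤ 1)
    (h0 : ∀ t, 0 ≤ x t) {M : ℝ} (hM : ∀ t, x t ≤ M) (hM0 : 0 < M) {t : ℝ}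
    (ht : t ∈ Icc (0 : ℝ) 1) (hxt : x.val t = M) : False := by
  have hb := hp.sub_bounds hn (m := 0) (by simpa using h0) hM
  have hval := hq.val_eq_neg_greenFun hx ht
  rw [hxt, greenFun_eq_intervalIntegral _ ht.1 ht.2, ← intervalIntegral.integral_neg] at hval
  simp_rw [← mul_neg] at hval
  have hlt := hq.lt_intervalIntegral_of_decay ((Tp - Tn) x).integrable.neg
    ((Tn 1).integrable.const_mul M)
    (hn.apply_one_nonneg.mono fun s hs => mul_nonneg hM0.le hs)
    (hb.mono fun s hs => by simpa using hs.2) ht.1 ht.2 le_rfl hM0 hval.le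
  have hB := integral_add_integral_le (Tn 1).integrable hn.apply_one_nonneg ht.1 ht.2 le_rfl
  rw [← hn.norm_eq, intervalIntegral.integral_same, add_zero] at hB
  rw [intervalIntegral.integral_const_mul] at hlt
  nlinarith [hB.2.2.trans hTn]

theorem IsSingularWeight.false_of_max_lt_min (hq : IsSingularWeight q) (hp : IsPositiveOp Tp)
    (hn : IsPositiveOp Tn) (hx : x + hq.greenOp ((Tp - Tn) x) = 0) (hTn : ‖Tn‖ ≤ 1)
    (hTp : ‖Tp‖ ≤ 2 * √(1 - ‖Tn‖)) {m M : ℝ} (hm : ∀ t, -m ≤ x t) (hm0 : 0 < m)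
    (hM : ∀ t, x t ≤ M) (hM0 : 0 < M) {t u : ℝ} (ht : 0 ≤ t) (htu : t < u) (hu : u ≤ 1)
    (hxt : x.val t = M) (hxu : x.val u = -m) : False := by
  have hb := hp.sub_bounds hn hm hM
  have hu0 : 0 < u := ht.trans_lt htu
  have hvt := hq.val_eq_neg_greenFun hx ⟨ht, htu.le.trans hu⟩
  have hvu := hq.val_eq_neg_greenFun hx ⟨hu0.le, hu⟩
  rw [hxu, neg_inj] at hvu
  rw [hxt, hq.greenFun_split ((Tp - Tn) x).integrable ht htu.le hu0 hu, ← hvu] at hvt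
  rw [greenFun_eq_intervalIntegral _ hu0.le hu] at hvu
  -- The part of the integral beyond `u` contributes `-(E t / E u) m` to `M`, so dropping it only
  -- weakens the bound.
  have hθ : 0 ≤ decay q t / decay q u * m :=
    mul_nonneg (div_nonneg (decay_nonneg _) (decay_nonneg _)) hm0.le
  have h1 : M ≤ ∫ s in t..u, decay q t / decay q s * -((Tp - Tn) x s) := by
    simp_rw [mul_neg]
    rw [intervalIntegral.integral_neg]
    linarith
  have ha := (Tp 1).integrable
  have hbi := (Tn 1).integrable
  have hlt1 := hq.lt_intervalIntegral_of_decay ((Tp - Tn) x).integrable.neg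
    ((ha.const_mul m).add (hbi.const_mul M))
    (by filter_upwards [hp.apply_one_nonneg, hn.apply_one_nonneg] with s h2 h3
        exact add_nonneg (mul_nonneg hm0.le h2) (mul_nonneg hM0.le h3))
    (hb.mono fun s hs => hs.2) ht htu.le hu hM0 h1
  have hlt2 := hq.lt_intervalIntegral_of_decay ((Tp - Tn) x).integrable
    ((ha.const_mul M).add (hbi.const_mul m))
    (by filter_upwards [hp.apply_one_nonneg, hn.apply_one_nonneg] with s h2 h3
        exact add_nonneg (mul_nonneg hM0.le h2) (mul_nonneg hm0.le h3))
    (hb.mono fun s hs => hs.1) hu0.le hu le_rfl hm0 hvu.le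
  simp only [Pi.add_apply] at hlt1 hlt2
  rw [integral_mul_add_mul ha hbi ht htu.le hu] at hlt1
  rw [integral_mul_add_mul ha hbi hu0.le hu le_rfl] at hlt2
  obtain ⟨ha1, ha2, hA⟩ := integral_add_integral_le ha hp.apply_one_nonneg ht htu.le hu
  obtain ⟨hb1, hb2, hB⟩ := integral_add_integral_le hbi hn.apply_one_nonneg ht htu.le hu
  rw [← hp.norm_eq] at hA
  rw [← hn.norm_eq] at hB
  set a1 := ∫ s in t..u, Tp 1 s
  set a2 := ∫ s in u..1, Tp 1 s
  set b1 := ∫ s in t..u, Tn 1 s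
  set b2 := ∫ s in u..1, Tn 1 s
  have hsq : ‖Tp‖ ^ 2 ≤ 4 * (1 - ‖Tn‖) := by
    calc ‖Tp‖ ^ 2 ≤ (2 * √(1 - ‖Tn‖)) ^ 2 := by gcongr
      _ = 4 * (1 - ‖Tn‖) := by rw [mul_pow, Real.sq_sqrt (by linarith)]; norm_num
  have hc1 : M * (1 - b1) < m * a1 := by linarith
  have hc2 : m * (1 - b2) < M * a2 := by linarith
  have hprod : (M * (1 - b1)) * (m * (1 - b2)) < (m * a1) * (M * a2) :=
    mul_lt_mul'' hc1 hc2 (mul_nonneg hM0.le (by linarith)) (mul_nonneg hm0.le (by linarith))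
  have hprod' : (1 - b1) * (1 - b2) < a1 * a2 := by
    refine lt_of_mul_lt_mul_left ?_ (mul_pos hM0 hm0).le
    linarith
  -- `1 - ‖Tn‖ ≤ (1 - b1)(1 - b2)`, whereas `a1 a2 ≤ (a1 + a2)² / 4 ≤ 1 - ‖Tn‖`.
  nlinarith [sq_nonneg (a1 - a2), mul_nonneg hb1 hb2, mul_self_le_mul_self (add_nonneg ha1 ha2) hA]

theorem IsSingularWeight.eq_zero_of_add_greenOp_eq_zero (hq : IsSingularWeight q)
    (hp : IsPositiveOp Tp) (hn : IsPositiveOp Tn) (hx : x + hq.greenOp ((Tp - Tn) x) = 0)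
    (hTn : ‖Tn‖ ≤ 1) (hTp : ‖Tp‖ ≤ 2 * √(1 - ‖Tn‖)) : x = 0 := by
  -- By this symmetry the maximum may be assumed to precede the minimum.
  have hx' : -x + hq.greenOp ((Tp - Tn) (-x)) = 0 := by
    rw [map_neg, map_neg, ← neg_add, hx, neg_zero]
  obtain ⟨t, ht⟩ : ∃ t, IsMaxOn x univ t := by
    simpa using isCompact_univ.exists_isMaxOn univ_nonempty x.continuous.continuousOn
  obtain ⟨u, hu⟩ : ∃ u, IsMinOn x univ u := by
    simpa using isCompact_univ.exists_isMinOn univ_nonempty x.continuous.continuousOn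
  have hM : ∀ s, x s ≤ x t := fun s => ht (mem_univ s)
  have hm : ∀ s, x u ≤ x s := fun s => hu (mem_univ s)
  have hx0 : x 0 = 0 := by
    have := hq.val_eq_neg_greenFun hx ⟨le_rfl, zero_le_one⟩
    rwa [greenFun_zero, neg_zero, SpaceC.val_of_mem] at this
  have hM0 : 0 ≤ x t := hx0.symm.trans_le (hM 0)
  have hm0 : x u ≤ 0 := (hm 0).trans_eq hx0
  have hneg : ∀ s, (-x).val s = -x.val s := fun s => rfl
  rcases hM0.eq_or_lt with hM0 | hM0
  · rcases hm0.eq_or_lt with hm0 | hm0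
    · ext s
      exact le_antisymm ((hM s).trans_eq hM0.symm) (hm0.symm.trans_le (hm s))
    · refine (hq.false_of_pos_max hp hn hx' hTn (M := -x u) (fun s => ?_) (fun s => ?_)
        (by linarith) u.2 (by rw [hneg, SpaceC.val_coe])).elim
      · rw [ContinuousMap.neg_apply]
        linarith [hM s]
      · exact neg_le_neg (hm s)
  · rcases hm0.eq_or_lt with hm0 | hm0
    · exact (hq.false_of_pos_max hp hn hx hTn (fun s => hm0.symm.trans_le (hm s)) hM hM0 t.2
        (SpaceC.val_coe x t)).elim
    · rcases lt_trichotomy (t : ℝ) u with htu | htu | htu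
      · exact (hq.false_of_max_lt_min hp hn hx hTn hTp (m := -x u) (by simpa using hm)
          (by linarith) hM hM0 t.2.1 htu u.2.2 (SpaceC.val_coe x t)
          (by rw [SpaceC.val_coe, neg_neg])).elim
      · rw [Subtype.ext htu] at hM0
        linarith
      · exact (hq.false_of_max_lt_min hp hn hx' hTn hTp (m := x t) (M := -x u)
          (by simpa using hM) hM0 (by simpa using hm)
          (by linarith) u.2.1 htu t.2.2 (by rw [hneg, SpaceC.val_coe])
          (by rw [hneg, SpaceC.val_coe])).elim

end maximum

/-! ### Rank-one operators and adjustment of norms. -/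

section rankOne

theorem IsPositiveOp.add {S T : SpaceC →L[ℝ] SpaceL} (hS : IsPositiveOp S) (hT : IsPositiveOp T) :
    IsPositiveOp (S + T) := by
  intro x hx
  filter_upwards [hS x hx, hT x hx, Lp.coeFn_add (S x) (T x)] with s h1 h2 h3
  rw [add_apply, h3]
  exact add_nonneg h1 h2

theorem IsPositiveOp.norm_eq_norm_apply_one {T : SpaceC →L[ℝ] SpaceL} (hT : IsPositiveOp T) :
    ‖T‖ = ‖T 1‖ := by
  rw [hT.norm_eq, L1.norm_eq_integral_norm]
  exact integral_congr_ae (hT.apply_one_nonneg.mono fun s hs => (Real.norm_of_nonneg hs).symm)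

theorem IsPositiveOp.norm_add {S T : SpaceC →L[ℝ] SpaceL} (hS : IsPositiveOp S)
    (hT : IsPositiveOp T) : ‖S + T‖ = ‖S‖ + ‖T‖ := by
  rw [hS.norm_eq, hT.norm_eq, (hS.add hT).norm_eq,
    ← integral_add (S 1).integrable (T 1).integrable]
  exact integral_congr_ae (Lp.coeFn_add (S 1) (T 1))

/-- The operator `x ↦ x(t) φ`. -/
noncomputable def evalSmul (t : Icc (0 : ℝ) 1) (φ : SpaceL) : SpaceC →L[ℝ] SpaceL :=
  (ContinuousMap.evalCLM ℝ t).smulRight φ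

@[simp] theorem evalSmul_apply (t : Icc (0 : ℝ) 1) (φ : SpaceL) (x : SpaceC) :
    evalSmul t φ x = x t • φ := rfl

theorem isPositiveOp_evalSmul (t : Icc (0 : ℝ) 1) {φ : SpaceL}
    (hφ : ∀ᵐ s ∂lebesgue01, 0 ≤ φ s) : IsPositiveOp (evalSmul t φ) := by
  intro x hx
  filter_upwards [hφ, Lp.coeFn_smul (x t) φ] with s h1 h2
  rw [evalSmul_apply, h2]
  exact mul_nonneg (hx t) h1

theorem ae_nonneg_smul {φ : SpaceL} (hφ : ∀ᵐ s ∂lebesgue01, 0 ≤ φ s) {c : ℝ} (hc : 0 ≤ c) :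
    ∀ᵐ s ∂lebesgue01, 0 ≤ (c • φ) s := by
  filter_upwards [hφ, Lp.coeFn_smul c φ] with s h1 h2
  rw [h2]
  exact mul_nonneg hc h1

theorem norm_evalSmul (t : Icc (0 : ℝ) 1) {φ : SpaceL} (hφ : ∀ᵐ s ∂lebesgue01, 0 ≤ φ s) :
    ‖evalSmul t φ‖ = ‖φ‖ := by
  rw [(isPositiveOp_evalSmul t hφ).norm_eq_norm_apply_one]
  simp

theorem norm_const_one : ‖Lp.const 1 lebesgue01 (1 : ℝ)‖ = 1 := by
  rw [L1.norm_eq_integral_norm, integral_congr_ae (g := fun _ => (1 : ℝ))]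
  · simp
  · filter_upwards [Lp.coeFn_const (p := 1) (μ := lebesgue01) (1 : ℝ)] with s hs
    rw [hs]
    simp

/-- The norm of a positive operator may be increased without changing the operator on the
functions that vanish at `0`. -/
theorem IsPositiveOp.exists_norm_eq {T : SpaceC →L[ℝ] SpaceL} (hT : IsPositiveOp T) {A : ℝ}
    (hA : ‖T‖ ≤ A) :
    ∃ S : SpaceC →L[ℝ] SpaceL, IsPositiveOp S ∧ ‖S‖ = A ∧ ∀ x, x 0 = 0 → S x = T x := by
  have h1 : ∀ᵐ s ∂lebesgue01, 0 ≤ ((A - ‖T‖) • Lp.const 1 lebesgue01 (1 : ℝ) : SpaceL) s := by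
    refine ae_nonneg_smul ?_ (sub_nonneg.mpr hA)
    filter_upwards [Lp.coeFn_const (p := 1) (μ := lebesgue01) (1 : ℝ)] with s hs
    rw [hs]
    exact zero_le_one
  refine ⟨T + evalSmul 0 ((A - ‖T‖) • Lp.const 1 lebesgue01 (1 : ℝ)),
    hT.add (isPositiveOp_evalSmul 0 h1), ?_, fun x hx => ?_⟩
  · rw [hT.norm_add (isPositiveOp_evalSmul 0 h1), norm_evalSmul 0 h1, norm_smul, norm_const_one,
      Real.norm_of_nonneg (sub_nonneg.mpr hA)]
    ring
  · rw [add_apply, evalSmul_apply, hx, zero_smul, add_zero]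

end rankOne

/-! ### Sharpness of the inequalities. -/

section counterexample

variable {q : ℝ → ℝ}

theorem integral_indicator_Ioc_const {u v : ℝ} (hu : 0 ≤ u) (huv : u ≤ v) (hv : v ≤ 1) (c : ℝ) :
    ∫ s, (Ioc u v).indicator (fun _ => c) s ∂lebesgue01 = (v - u) * c := by
  rw [integral_indicator_const _ measurableSet_Ioc, lebesgue01,
    measureReal_restrict_apply measurableSet_Ioc, inter_eq_left.mpr
    (show Ioc u v ⊆ Icc 0 1 from fun s hs => ⟨hu.trans hs.1.le, hs.2.trans hv⟩),
    Real.volume_real_Ioc_of_le huv, smul_eq_mul]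

/-- A nonnegative function concentrated just after `τ`, of norm almost `1`, on which the Green
operator acts as on a unit mass at `τ`. -/
theorem IsSingularWeight.exists_bump (hq : IsSingularWeight q) {τ u ε : ℝ} (hτ : 0 < τ)
    (hτu : τ < u) (hu : u ≤ 1) (hε : 0 < ε) :
    ∃ φ : SpaceL, (∀ᵐ s ∂lebesgue01, 0 ≤ φ s) ∧ ‖φ‖ ≤ 1 + ε ∧
      (∀ t, t ≤ τ → greenFun q φ t = decay q t / decay q τ) ∧
      ∀ t, u ≤ t → greenFun q φ t = 0 := by
  have hE := decay_pos (q := q) hτ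
  obtain ⟨v, hvE, hv⟩ : ∃ v, decay q v < (1 + ε) * decay q τ ∧ v ∈ Ioo τ u := by
    have h1 : ∀ᶠ v in 𝓝[>] τ, decay q v < (1 + ε) * decay q τ :=
      ((hq.continuousAt_decay hτ (hτu.trans_le hu)).eventually_lt_const
        (by nlinarith)).filter_mono nhdsWithin_le_nhds
    exact (h1.and (Ioo_mem_nhdsGT hτu)).exists
  have hv1 : v ≤ 1 := hv.2.le.trans hu
  have hvτ : 0 < v - τ := sub_pos.mpr hv.1
  -- The factor `decay q s` cancels the denominator of the kernel, so the action to the left of `τ`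
  -- is exact; the price is a norm of at most `decay q v / decay q τ < 1 + ε`.
  set f : ℝ → ℝ := (Ioc τ v).indicator fun s => decay q s / (decay q τ * (v - τ)) with hf
  have hfi : Integrable f lebesgue01 := by
    have : IntegrableOn (decay q) (Icc 0 1) := hq.continuousOn_decay.integrableOn_Icc
    exact (this.div_const _).indicator measurableSet_Ioc
  have hf0 : ∀ s, 0 ≤ f s := fun s =>
    indicator_nonneg (fun s _ => div_nonneg (decay_nonneg _) (by positivity)) s
  have hco : (hfi.toL1 f : ℝ → ℝ) =ᵐ[lebesgue01] f := hfi.coeFn_toL1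
  refine ⟨hfi.toL1 f, hco.mono fun s hs => hs ▸ hf0 s, ?_, fun t ht => ?_, fun t ht => ?_⟩
  · rw [L1.norm_of_fun_eq_integral_norm]
    calc ∫ s, ‖f s‖ ∂lebesgue01
        ≤ ∫ s, (Ioc τ v).indicator (fun _ => (1 + ε) / (v - τ)) s ∂lebesgue01 := by
          refine integral_mono hfi.norm ((integrable_const _).indicator measurableSet_Ioc)
            fun s => ?_
          dsimp only
          rw [Real.norm_of_nonneg (hf0 s)]
          by_cases hs : s ∈ Ioc τ v
          · rw [hf, indicator_of_mem hs, indicator_of_mem hs, div_le_div_iff₀ (by positivity) hvτ,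
              ← mul_assoc]
            have := (hq.decay_le (hτ.le.trans hs.1.le) hs.2 hv1).trans hvE.le
            gcongr
          · rw [hf, indicator_of_notMem hs, indicator_of_notMem hs]
      _ = 1 + ε := by
          rw [integral_indicator_Ioc_const hτ.le hv.1.le hv1]
          field_simp
  · rw [greenFun_congr hco]
    calc greenFun q f t
        = ∫ s, (Ioc τ v).indicator
            (fun _ => decay q t / (decay q τ * (v - τ))) s ∂lebesgue01 := by
          refine integral_congr_ae (Eventually.of_forall fun s => ?_)
          by_cases hs : s ∈ Ioc τ v
          · have := (decay_pos (q := q) (hτ.trans hs.1)).ne'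
            simp only [hf, indicator_of_mem hs, greenKernel, if_pos (ht.trans_lt hs.1)]
            field_simp
          · simp [hf, indicator_of_notMem hs]
      _ = decay q t / decay q τ := by
          rw [integral_indicator_Ioc_const hτ.le hv.1.le hv1]
          field_simp
  · rw [greenFun_congr hco]
    refine integral_eq_zero_of_ae (Eventually.of_forall fun s => ?_)
    by_cases hs : s ∈ Ioc τ v
    · simp [greenKernel, (hs.2.trans (hv.2.le.trans ht)).not_gt]
    · simp [hf, indicator_of_notMem hs]

/-- The equation is the condition `x s₁ = 1` for the solution built below, `θ` being the ratio of
the two decay values. For `B ≤ 1` take `α₂ ≈ A/2`, `β ≈ B` and solve for `α₁ ≈ 2 (1 - B) / A`; then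
`α₁ + α₂ < A` since `4 (1 - B) < A²`, and the slack `D` absorbs `ε` and `θ`. -/
theorem exists_parameters {A B : ℝ} (hA : 0 ≤ A) (hB : 0 ≤ B)
    (h : ¬(B ≤ 1 ∧ A ≤ 2 * √(1 - B))) :
    ∃ ε > 0, ∃ θ₀ > 0, ∀ θ, 0 ≤ θ → θ ≤ θ₀ → ∃ α₁ α₂ β : ℝ, 0 ≤ α₁ ∧ 0 ≤ α₂ ∧ 0 ≤ β ∧
      α₁ * α₂ + β - α₂ * θ = 1 ∧ (α₁ + α₂) * (1 + ε) ≤ A ∧ β * (1 + ε) ≤ B := by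
  by_cases hB1 : B ≤ 1
  · have hA' : 2 * √(1 - B) < A := not_le.mp fun h' => h ⟨hB1, h'⟩
    have hA0 : 0 < A := (by positivity : 0 ≤ 2 * √(1 - B)).trans_lt hA'
    have hsq : 4 * (1 - B) < A ^ 2 := by
      calc 4 * (1 - B) = (2 * √(1 - B)) ^ 2 := by
            rw [mul_pow, Real.sq_sqrt (by linarith)]; norm_num
        _ < A ^ 2 := by gcongr
    set D := A ^ 2 / 4 - (1 - B) with hD
    have hD0 : 0 < D := by linarith
    refine ⟨min 1 (D / 6), by positivity, D / (2 * A), by positivity, fun θ hθ hθ' => ?_⟩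
    set ε := min 1 (D / 6)
    have hε0 : 0 < ε := by positivity
    have hε1 : ε ≤ 1 := min_le_left _ _
    have hε2 : ε ≤ D / 6 := min_le_right _ _
    have hβ : B / (1 + ε) ≤ 1 := by rw [div_le_one (by positivity)]; linarith
    refine ⟨θ + (1 - B / (1 + ε)) / (A / (2 * (1 + ε))), A / (2 * (1 + ε)), B / (1 + ε),
      ?_, by positivity, by positivity, ?_, ?_, ?_⟩
    · have := sub_nonneg.mpr hβ
      positivity
    · field_simp
      ring
    · have hθA : θ * A ≤ D / 2 := by
        rw [le_div_iff₀ (by positivity)] at hθ'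
        linarith
      -- The `θ` term costs at most `D/2`, and so does replacing `1 - B` by `(1 + ε - B)(1 + ε)`, as
      -- `3 ε ≤ D/2`.
      have key : (θ * A / 2 * (1 + ε) + (1 + ε - B) * (1 + ε)) ≤ A ^ 2 / 4 := by
        nlinarith [mul_nonneg hθ hA]
      have heq : (θ + (1 - B / (1 + ε)) / (A / (2 * (1 + ε))) + A / (2 * (1 + ε))) * (1 + ε)
          = (θ * A / 2 * (1 + ε) + (1 + ε - B) * (1 + ε)) * (2 / A) + A / 2 := by
        field_simp
      rw [heq]
      calc _ ≤ A ^ 2 / 4 * (2 / A) + A / 2 := by gcongr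
        _ = A := by field_simp; norm_num
    · rw [div_mul_cancel₀ _ (by positivity)]
  · push Not at hB1
    exact ⟨B - 1, by linarith, 1, one_pos, fun θ _ _ => ⟨0, 0, 1, le_rfl, le_rfl, zero_le_one,
      by ring, by simpa using hA, by linarith⟩⟩

/-- On functions vanishing at `0`, `Tp x = x(s₂) α₁ φ₁ + x(s₁) α₂ φ₂` and `Tn x = x(s₁) β φ₁`, with
bumps just after `s₁ = t₁` and `s₂ = 1/2`. This imitates the extremal case of the uniqueness
argument, with extrema at `s₁` and `s₂`. -/
theorem IsSingularWeight.exists_ne_zero_of_not_le (hq : IsSingularWeight q) {A B : ℝ} (hA : 0 ≤ A)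
    (hB : 0 ≤ B) (h : ¬(B ≤ 1 ∧ A ≤ 2 * √(1 - B))) :
    ∃ Tp Tn : SpaceC →L[ℝ] SpaceL, IsPositiveOp Tp ∧ IsPositiveOp Tn ∧ ‖Tp‖ = A ∧ ‖Tn‖ = B ∧
      ∃ x : SpaceC, x ≠ 0 ∧ x + hq.greenOp ((Tp - Tn) x) = 0 := by
  obtain ⟨ε, hε, θ₀, hθ₀, hpar⟩ := exists_parameters hA hB h
  have hE2 : 0 < decay q (1 / 2) := decay_pos (by norm_num)
  obtain ⟨t₁, ht₁, ht₁'⟩ : ∃ t, decay q t < θ₀ * decay q (1 / 2) ∧ t ∈ Ioo (0 : ℝ) (1 / 2) := by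
    have h1 : Tendsto (decay q) (𝓝[Icc 0 1] 0) (𝓝 0) := by
      simpa [ContinuousWithinAt] using hq.continuousOn_decay 0 ⟨le_rfl, zero_le_one⟩
    have h2 : ∀ᶠ t in 𝓝[>] (0 : ℝ), decay q t < θ₀ * decay q (1 / 2) :=
      (h1.eventually_lt_const (by positivity)).filter_mono
        (nhdsWithin_le_of_mem (Icc_mem_nhdsGT one_pos))
    exact (h2.and (Ioo_mem_nhdsGT (by norm_num))).exists
  obtain ⟨φ₁, hφ₁, hn₁, hg₁, hz₁⟩ := hq.exists_bump ht₁'.1 ht₁'.2 (by norm_num) hε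
  obtain ⟨φ₂, hφ₂, hn₂, hg₂, -⟩ :=
    hq.exists_bump (τ := 1 / 2) (u := 1) (by norm_num) (by norm_num) le_rfl hε
  set θ := decay q t₁ / decay q (1 / 2)
  obtain ⟨α₁, α₂, β, hα₁, hα₂, hβ, heq, hAle, hBle⟩ := hpar θ
    (div_nonneg (decay_nonneg _) (decay_nonneg _)) (by rw [div_le_iff₀ hE2]; exact ht₁.le)
  let s₁ : Icc (0 : ℝ) 1 := ⟨t₁, ht₁'.1.le, by linarith [ht₁'.2]⟩
  let s₂ : Icc (0 : ℝ) 1 := ⟨1 / 2, by norm_num, by norm_num⟩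
  have hp₁ := isPositiveOp_evalSmul s₂ (ae_nonneg_smul hφ₁ hα₁)
  have hp₂ := isPositiveOp_evalSmul s₁ (ae_nonneg_smul hφ₂ hα₂)
  have hp₃ := isPositiveOp_evalSmul s₁ (ae_nonneg_smul hφ₁ hβ)
  obtain ⟨Tp, hTp, hTpA, hTpx⟩ := (hp₁.add hp₂).exists_norm_eq (A := A) <| by
    rw [hp₁.norm_add hp₂, norm_evalSmul _ (ae_nonneg_smul hφ₁ hα₁),
      norm_evalSmul _ (ae_nonneg_smul hφ₂ hα₂), norm_smul, norm_smul, Real.norm_of_nonneg hα₁,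
      Real.norm_of_nonneg hα₂]
    refine le_trans ?_ hAle
    rw [add_mul]
    gcongr
  obtain ⟨Tn, hTn, hTnB, hTnx⟩ := hp₃.exists_norm_eq (A := B) <| by
    rw [norm_evalSmul _ (ae_nonneg_smul hφ₁ hβ), norm_smul, Real.norm_of_nonneg hβ]
    refine le_trans ?_ hBle
    gcongr
  have hG₁₁ : hq.greenOp φ₁ s₁ = 1 :=
    (hg₁ t₁ le_rfl).trans (div_self (decay_pos ht₁'.1).ne')
  have hG₁₂ : hq.greenOp φ₁ s₂ = 0 := hz₁ _ le_rfl
  have hG₂₁ : hq.greenOp φ₂ s₁ = θ := hg₂ t₁ ht₁'.2.le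
  have hG₂₂ : hq.greenOp φ₂ s₂ = 1 := (hg₂ _ le_rfl).trans (div_self hE2.ne')
  -- This is `-G ((Tp - Tn) x)` computed with `x s₁ = 1` and `x s₂ = -α₂`; the two values are then
  -- verified.
  set x : SpaceC := (α₁ * α₂ + β) • hq.greenOp φ₁ - α₂ • hq.greenOp φ₂ with hx
  have hx₁ : x s₁ = 1 := by
    simp only [hx, ContinuousMap.sub_apply, ContinuousMap.smul_apply, hG₁₁, hG₂₁, smul_eq_mul]
    linarith
  have hx₂ : x s₂ = -α₂ := by
    simp only [hx, ContinuousMap.sub_apply, ContinuousMap.smul_apply, hG₁₂, hG₂₂, smul_eq_mul]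
    ring
  have hG0 : ∀ φ, hq.greenOp φ 0 = 0 := fun φ => greenFun_zero φ
  have hx0 : x 0 = 0 := by simp [hx, hG0]
  refine ⟨Tp, Tn, hTp, hTn, hTpA, hTnB, x, fun h0 => ?_, ?_⟩
  · rw [h0] at hx₁
    exact zero_ne_one hx₁
  · rw [sub_apply, hTpx x hx0, hTnx x hx0, add_apply, evalSmul_apply, evalSmul_apply,
      evalSmul_apply, hx₁, hx₂]
    simp only [map_sub, map_add, map_smul, hx]
    module

end counterexample

/-! ### Reduction to `k = -1` and conclusion. -/

section main

variable {q : ℝ → ℝ}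

theorem IsSingularWeight.const_mul {p : ℝ → ℝ} (hp : IsSingularWeight p) {c : ℝ} (hc : 0 < c) :
    IsSingularWeight fun t => c * p t where
  pos t ht := mul_pos hc (hp.pos t ht)
  integrableOn ε hε := (hp.integrableOn ε hε).const_mul c
  tendsto_integral := by
    simp_rw [intervalIntegral.integral_const_mul]
    exact hp.tendsto_integral.const_mul_atTop hc

theorem solvesProblem_iff_neg_one {k : ℝ} {p : ℝ → ℝ} {T : SpaceC →L[ℝ] SpaceL} {f : SpaceL}
    {c : ℝ} {x : SpaceC} :
    SolvesProblem k p T f c x ↔ SolvesProblem (-1) (fun t => -k * p t) T f c x := by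
  simp [SolvesProblem, DMinus, SolvesModel]

theorem UniquelySolvableForced.uniquelySolvable {k : ℝ} {p : ℝ → ℝ} {T : SpaceC →L[ℝ] SpaceL}
    (h : UniquelySolvableForced k p T) : UniquelySolvable k p T := h 0

theorem uniquelySolvableForced_of_le {p : ℝ → ℝ} (hp : IsSingularWeight p) {k : ℝ} (hk : k < 0)
    {Tp Tn : SpaceC →L[ℝ] SpaceL} (hTp : IsPositiveOp Tp) (hTn : IsPositiveOp Tn)
    (h1 : ‖Tn‖ ≤ 1) (h2 : ‖Tp‖ ≤ 2 * √(1 - ‖Tn‖)) : UniquelySolvableForced k p (Tp - Tn) := by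
  have hq := hp.const_mul (neg_pos.mpr hk)
  have hbij := hq.bijective_add_greenOp (T := Tp - Tn) (h := fun s => Tp 1 s + Tn 1 s)
    ((Tp 1).integrable.add (Tn 1).integrable)
    (fun x => by
      filter_upwards [hTp.abs_le x, hTn.abs_le x, Lp.coeFn_sub (Tp x) (Tn x)] with s h3 h4 h5
      rw [sub_apply, h5, Pi.sub_apply, mul_add]
      exact (abs_sub _ _).trans (add_le_add h3 h4))
    (fun x hx => hq.eq_zero_of_add_greenOp_eq_zero hTp hTn hx h1 h2)
  intro f c
  simp_rw [solvesProblem_iff_neg_one (k := k), solvesProblem_iff hq]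
  exact hbij.existsUnique _

theorem le_of_forall_uniquelySolvable {p : ℝ → ℝ} (hp : IsSingularWeight p) {k : ℝ} (hk : k < 0)
    {A B : ℝ} (hA : 0 ≤ A) (hB : 0 ≤ B)
    (h : ∀ Tp Tn : SpaceC →L[ℝ] SpaceL, IsPositiveOp Tp → IsPositiveOp Tn → ‖Tp‖ = A → ‖Tn‖ = B →
      UniquelySolvable k p (Tp - Tn)) : B ≤ 1 ∧ A ≤ 2 * √(1 - B) := by
  by_contra hcon
  have hq := hp.const_mul (neg_pos.mpr hk)
  obtain ⟨Tp, Tn, hTp, hTn, hTpA, hTnB, x, hx0, hx⟩ := hq.exists_ne_zero_of_not_le hA hB hcon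
  have huniq := (h Tp Tn hTp hTn hTpA hTnB 0).unique (y₁ := x) (y₂ := 0)
  simp only [solvesProblem_iff_neg_one (k := k), solvesProblem_iff hq] at huniq
  exact hx0 (huniq (by simpa using hx) (by simp))

end main

theorem mainTheorem4 (p : ℝ → ℝ) (hp : IsSingularWeight p) (k : ℝ) (hk : k < 0)
    (τpos τneg : ℝ) (hτpos : 0 ≤ τpos) (hτneg : 0 ≤ τneg) :
    ((∀ Tpos Tneg : SpaceC →L[ℝ] SpaceL, IsPositiveOp Tpos → IsPositiveOp Tneg →
        ‖Tpos‖ = τpos → ‖Tneg‖ = τneg → UniquelySolvable k p (Tpos - Tneg)) ↔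
      (τneg ≤ 1 ∧ τpos ≤ 2 * Real.sqrt (1 - τneg))) ∧
    ((∀ Tpos Tneg : SpaceC →L[ℝ] SpaceL, IsPositiveOp Tpos → IsPositiveOp Tneg →
        ‖Tpos‖ = τpos → ‖Tneg‖ = τneg → UniquelySolvableForced k p (Tpos - Tneg)) ↔
      (τneg ≤ 1 ∧ τpos ≤ 2 * Real.sqrt (1 - τneg))) := by
  -- The forced problem contains the unforced one: sufficiency is proved for the former, necessity
  -- for the latter.
  have hsuff : (τneg ≤ 1 ∧ τpos ≤ 2 * Real.sqrt (1 - τneg)) →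
      ∀ Tpos Tneg : SpaceC →L[ℝ] SpaceL, IsPositiveOp Tpos → IsPositiveOp Tneg →
        ‖Tpos‖ = τpos → ‖Tneg‖ = τneg → UniquelySolvableForced k p (Tpos - Tneg) := by
    rintro ⟨h1, h2⟩ Tp Tn hTp hTn rfl rfl
    exact uniquelySolvableForced_of_le hp hk hTp hTn h1 h2
  refine ⟨⟨le_of_forall_uniquelySolvable hp hk hτpos hτneg, fun h Tp Tn h1 h2 h3 h4 =>
    (hsuff h Tp Tn h1 h2 h3 h4).uniquelySolvable⟩, ⟨fun h => ?_, hsuff⟩⟩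
  exact le_of_forall_uniquelySolvable hp hk hτpos hτneg fun Tp Tn h1 h2 h3 h4 =>
    (h Tp Tn h1 h2 h3 h4).uniquelySolvable
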